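/- For groups $A$ and $B$ let $A\,\mathrm{Wr}\,B$ be their cartesian (unrestricted) standard wreath product, i.e. the set of pairs $(f,b)$ with $f\colon B\to A$ and $b\in B$, multiplied by $(f,b)(f',b')=(g,bb')$, $g(x)=f(x)f'(b^{-1}x)$, and let $A\,\mathrm{wr}\,B$ be the direct (restricted) wreath product, the subgroup of all $(f,b)$ with $f$ of finite support. Let $\mathrm{var}(G)$ be the variety of groups generated by a group $G$, i.e. the class of all groups that satisfy every identity of $G$. For varieties $\mathfrak U,\mathfrak V$ let $\mathfrak U\mathfrak V$ be the class of all groups $G$ that have a normal subgroup $N\in\mathfrak U$ with $G/N\in\mathfrak V$. Theorem. Let $A$ and $B$ be arbitrary abelian groups. The equality $\mathrm{var}(A\,\mathrm{Wr}\,B)=\mathrm{var}(A)\,\mathrm{var}(B)$ holds if and only if one of the following holds: (1) at least one of the groups $A$ and $B$ is not of finite exponent; or (2) the exponents $m=\exp A$ and $n=\exp B$ are both finite and, for every common prime divisor $p$ of $m$ and $n$, the $p$-primary component $B_p=\{b\in B : |b|=p^i\text{ for some } i\ge 0\}$ has a decomposition $B_p\cong\bigoplus_{i\in I}C_{p^{k_i}}$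 into finite cyclic groups in which infinitely many of the summands have order $p^{k'}$, where $p^{k'}$ is the highest power of $p$ dividing $n$. Likewise, $\mathrm{var}(A\,\mathrm{wr}\,B)=\mathrm{var}(A)\,\mathrm{var}(B)$ holds if and only if (1) or (2) holds. -/

import Mathlib

universe u v w

/-- The group `G` satisfies the law (identity) `x ≡ 1`, where `x` is a word in countably many
variables: every substitution of elements of `G` for the variables turns `x` into `1`. -/
def SatisfiesLaw (G : Type u) [Group G] (x : FreeGroup ℕ) : Prop :=
  ∀ f : ℕ → G, FreeGroup.lift f x = 1

/-- The variety of groups defined by a set `S` of laws, as a class of groups in universe `w`. -/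
def varietyOfLaws (S : Set (FreeGroup ℕ)) : Set GrpCat.{w} :=
  {H | ∀ x ∈ S, SatisfiesLaw H x}

/-- The variety `var G` generated by `G`: the intersection of all the varieties that contain `G`,
that is, of the varieties defined by those sets of laws which `G` satisfies. It consists
of groups in a universe `w` which need not be the universe of `G`. -/
def generatedVariety (G : Type u) [Group G] : Set GrpCat.{w} :=
  ⋂ (S : Set (FreeGroup ℕ)) (_ : ∀ x ∈ S, SatisfiesLaw G x), varietyOfLaws.{w} S

/-- The product `U V` of two classes of groups: all the extensions of a group from `U` by a group
from `V`, that is, all groups `G` with a normal subgroup `N ∈ U` such that `G ⧸ N ∈ V`. -/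
def productVariety (U V : Set GrpCat.{w}) : Set GrpCat.{w} :=
  {G | ∃ (N : Subgroup G) (_ : N.Normal), GrpCat.of N ∈ U ∧ GrpCat.of (G ⧸ N) ∈ V}

/-- The direct (restricted) standard wreath product of `A` and `B`: the subgroup of the cartesian
wreath product `A ≀ᵣ B` formed by the pairs `(f, b)` where `f : B → A` has finite support. -/
def directWreathProduct (A : Type u) (B : Type v) [Group A] [Group B] : Subgroup (A ≀ᵣ B) where
  carrier := {g | (Function.mulSupport g.left).Finite}
  one_mem' := by simp
  mul_mem' := by
    intro a b ha hb
    have hb' : (Function.mulSupport fun x ↦ b.left (a.right⁻¹ * x)).Finite :=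
      Set.Finite.preimage (f := fun x ↦ a.right⁻¹ * x) (mul_right_injective _).injOn hb
    exact (ha.union hb').subset (Function.mulSupport_mul _ _)
  inv_mem' := by
    intro a ha
    have ha' : (Function.mulSupport fun x ↦ a.left (a.right * x)).Finite :=
      Set.Finite.preimage (f := fun x ↦ a.right * x) (mul_right_injective _).injOn ha
    refine ha'.subset fun x hx ↦ ?_
    simpa using hx

/-- The `p`-primary component of `B` is a direct sum of finite cyclic `p`-groups, infinitely many
of which have order `p ^ k'`. -/
def HasInfinitelyManySummands (B : Type v) [CommGroup B] (p k' : ℕ) : Prop :=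
  ∃ (I : Type v) (k : I → ℕ),
    Nonempty (Additive (CommGroup.primaryComponent B p) ≃+ DirectSum I fun i ↦ ZMod (p ^ k i)) ∧
      {i : I | k i = k'}.Infinite

/-- The criterion: at least one of `A` and `B` is not of finite exponent; or both exponents are
finite and, for every common prime divisor `p` of them, the `p`-primary component of `B` has
infinitely many cyclic direct summands of order `p ^ k'`, where `p ^ k'` is the highest power of
`p` dividing the exponent of `B`. -/
def WreathCriterion (A : Type u) (B : Type v) [CommGroup A] [CommGroup B] : Prop :=
  (¬ Monoid.ExponentExists A ∨ ¬ Monoid.ExponentExists B) ∨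
    (Monoid.ExponentExists A ∧ Monoid.ExponentExists B ∧
      ∀ p : ℕ, p.Prime → p ∣ Monoid.exponent A → p ∣ Monoid.exponent B →
        HasInfinitelyManySummands B p ((Monoid.exponent B).factorization p))

/-!
Let `N` and `Q` be abelian groups from `var A` and `var B`. By the Kaloujnine–Krasner embedding,
the wreath products `N ≀ᵣ Q` generate `(var A)(var B)`. Fox calculus describes their laws: a law
of `Q` is a law of `N ≀ᵣ Q` if the values in `ℤ[Q]` of its Fox derivatives are divisible by the
exponent of `N`, and a law of the direct wreath product of `A` and `B` has derivatives divisible by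
`m = exp A` in `ℤ[B]`. It suffices to compute the derivatives in the group ring of a direct sum `V`
of infinitely many copies of `ℤ/n`, where `n = exp B`, and to detect their divisibility by `m` on
the images under the homomorphisms `V → B`. If `n = 0`, these separate the points of every finite
subset of `V`. If `n ≠ 0`, a Fourier inversion with Möbius weights deals with the powers of the
primes that do not divide `n`, and also with `m = 0`; for a common prime `p` of `m` and `n`, the
summands provided by the criterion embed the `p`-component of `V` in `B`.

If the criterion fails at `p`, Prüfer's theorem shows that the set `T` of the powers `b ^ (n / p)`
is finite. Since `(1 - t) ^ p` is divisible by `p` in `ℤ[B]` for every `t ∈ T`, so is every product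
of `|T| p` factors `1 - t`. Hence `A ≀ᵣ B` has the law
`[[x₀, x₁], x₂ ^ (n / p), x₃ ^ (n / p), …] ^ (m / p)`, with `|T| p` powers, which fails in the
wreath product of the cyclic group of order `m` with an infinite power of that of order `n`.
-/

open scoped DirectSum

/-- The family `y` is a basis of the abelian group `M` in the sense that `M` is the direct sum of
the cyclic subgroups generated by the `y i`, where `y i` has order `n i`. -/
structure IsCyclicBasis {I M : Type*} [AddCommGroup M] (y : I → M) (n : I → ℕ) : Prop where
  linearCombination_eq_zero_iff (c : I →₀ ℤ) :
    Finsupp.linearCombination ℤ y c = 0 ↔ ∀ i, (n i : ℤ) ∣ c i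
  linearCombination_surjective : Function.Surjective (Finsupp.linearCombination ℤ y)

section CyclicBasis

open Finsupp

variable {I J M N : Type*} [AddCommGroup M] [AddCommGroup N]

theorem map_linearCombination_int (f : M →+ N) (y : I → M) (c : I →₀ ℤ) :
    f (linearCombination ℤ y c) = linearCombination ℤ (f ∘ y) c :=
  apply_linearCombination ℤ f.toIntLinearMap y c

theorem IsCyclicBasis.nonempty_addEquiv {y : I → M} {n : I → ℕ} (h : IsCyclicBasis y n) :
    Nonempty (M ≃+ ⨁ i, ZMod (n i)) := by
  classical
  let π : (I →₀ ℤ) →+ ⨁ i, ZMod (n i) :=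
    (DirectSum.map fun i ↦ Int.castAddHom (ZMod (n i))).comp
      (finsuppLEquivDirectSum ℤ ℤ I).toAddEquiv.toAddMonoidHom
  have π_apply (c : I →₀ ℤ) (i : I) : π c i = c i := rfl
  have π_surjective : Function.Surjective π :=
    ((DirectSum.map_surjective _).2 fun i ↦ ZMod.intCast_surjective).comp
      (finsuppLEquivDirectSum ℤ ℤ I).surjective
  have ker_eq : (linearCombination ℤ y).toAddMonoidHom.ker = π.ker := by
    ext c
    change linearCombination ℤ y c = 0 ↔ π c = 0
    rw [h.linearCombination_eq_zero_iff, DirectSum.ext_iff]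
    simp [π_apply, ZMod.intCast_zmod_eq_zero_iff_dvd]
  exact ⟨(QuotientAddGroup.quotientKerEquivOfSurjective _ h.linearCombination_surjective).symm.trans
    ((QuotientAddGroup.quotientAddEquivOfEq ker_eq).trans
      (QuotientAddGroup.quotientKerEquivOfSurjective π π_surjective))⟩

theorem exists_isCyclicBasis_of_prime_nsmul {V : Type v} [AddCommGroup V] {p : ℕ} (hp : p.Prime)
    (h : ∀ x : V, p • x = 0) : ∃ (J : Type v) (b : J → V), IsCyclicBasis b fun _ ↦ p := by
  have : Fact p.Prime := ⟨hp⟩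
  have : Module (ZMod p) V := AddCommGroup.zmodModule h
  obtain ⟨J, ⟨b⟩⟩ : ∃ J : Type v, Nonempty (Module.Basis J (ZMod p) V) :=
    ⟨_, ⟨Module.Basis.ofVectorSpace _ _⟩⟩
  have reduce (c : J →₀ ℤ) :
      linearCombination ℤ b c =
        linearCombination (ZMod p) b (c.mapRange (Int.castAddHom (ZMod p)) (map_zero _)) := by
    rw [linearCombination_apply, linearCombination_apply, sum_mapRange_index (by simp)]
    simp [Int.cast_smul_eq_zsmul]
  refine ⟨_, b, fun c ↦ ?_, fun x ↦ ?_⟩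
  · rw [reduce, ← (linearCombination (ZMod p) b).map_zero, b.linearIndependent.eq_iff]
    simp [Finsupp.ext_iff, ZMod.intCast_zmod_eq_zero_iff_dvd]
  · obtain ⟨c, hc⟩ := mapRange_surjective (Int.castAddHom (ZMod p)) (map_zero _)
      ZMod.intCast_surjective (b.repr x)
    exact ⟨c, by rw [reduce, hc, b.linearCombination_repr]⟩

theorem exists_eq_nsmul_of_forall_dvd {p : ℕ} {c : I →₀ ℤ} (h : ∀ i, (p : ℤ) ∣ c i) :
    ∃ c', c = p • c' :=
  ⟨c.mapRange (· / p) (Int.zero_ediv _), Finsupp.ext fun i ↦ by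
    simp [Int.mul_ediv_cancel' (h i)]⟩

theorem exists_torsion_basis_mod {M : Type v} [AddCommGroup M] {p : ℕ} (hp : p.Prime)
    (U : AddSubgroup M) : ∃ (J : Type v) (b : J → M), (∀ j, p • b j = 0) ∧
      (∀ d, linearCombination ℤ b d ∈ U → ∀ j, (p : ℤ) ∣ d j) ∧
      ∀ x, p • x = 0 → ∃ d, x - linearCombination ℤ b d ∈ U := by
  -- `b` lifts a basis of the `𝔽_p`-vector space `T / (T ∩ U)`, where `T` is the `p`-torsion.
  let T : AddSubgroup M := (nsmulAddMonoidHom p).ker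
  let q : T →+ T ⧸ U.addSubgroupOf T := QuotientAddGroup.mk' _
  have hq (x : T ⧸ U.addSubgroupOf T) : p • x = 0 := by
    obtain ⟨x, rfl⟩ := QuotientAddGroup.mk'_surjective _ x
    rw [← map_nsmul, show p • x = 0 from Subtype.ext x.2, map_zero]
  obtain ⟨J, b, hb⟩ := exists_isCyclicBasis_of_prime_nsmul hp hq
  choose t ht using fun j ↦ QuotientAddGroup.mk'_surjective (U.addSubgroupOf T) (b j)
  obtain rfl : q ∘ t = b := funext ht
  have val_lc (d : J →₀ ℤ) : (linearCombination ℤ t d : M) =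
      linearCombination ℤ (fun j ↦ (t j : M)) d :=
    map_linearCombination_int T.subtype t d
  refine ⟨J, fun j ↦ t j, fun j ↦ (t j).2, fun d hd ↦ ?_, fun x hx ↦ ?_⟩
  · rw [← hb.linearCombination_eq_zero_iff, ← map_linearCombination_int]
    exact (QuotientAddGroup.eq_zero_iff _).2 (AddSubgroup.mem_addSubgroupOf.2 (val_lc d ▸ hd))
  · obtain ⟨d, hd⟩ := hb.linearCombination_surjective (q ⟨x, hx⟩)
    rw [← map_linearCombination_int, eq_comm, ← sub_eq_zero, ← map_sub] at hd
    have := AddSubgroup.mem_addSubgroupOf.1 ((QuotientAddGroup.eq_zero_iff _).1 hd)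
    exact ⟨d, by simpa [val_lc] using this⟩

theorem linearCombination_eq_zero_of_forall_dvd {p : ℕ} {b : J → M} (hb : ∀ j, p • b j = 0)
    {d : J →₀ ℤ} (hd : ∀ j, (p : ℤ) ∣ d j) : linearCombination ℤ b d = 0 := by
  obtain ⟨d, rfl⟩ := exists_eq_nsmul_of_forall_dvd hd
  rw [linearCombination_apply, Finsupp.sum, Finset.sum_eq_zero]
  intro j _
  rw [Finsupp.smul_apply, smul_assoc, smul_comm, hb, smul_zero]

theorem IsCyclicBasis.linearCombination_eq_zero_iff_of_nsmul {p : ℕ} (hp : p ≠ 0) {n : I → ℕ}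
    (hn : ∀ i, p ∣ n i) {t : I → M}
    (ht : IsCyclicBasis ((nsmulAddMonoidHom p : M →+ M).rangeRestrict ∘ t) n) (c : I →₀ ℤ) :
    linearCombination ℤ t c = 0 ↔ ∀ i, ((p * n i : ℕ) : ℤ) ∣ c i := by
  have nsmul_eq_zero_iff (c : I →₀ ℤ) :
      p • linearCombination ℤ t c = 0 ↔ ∀ i, (n i : ℤ) ∣ c i := by
    rw [← ht.linearCombination_eq_zero_iff,
      ← map_linearCombination_int]
    rw [Subtype.ext_iff]
    rfl
  suffices h : (∀ i, (p : ℤ) ∣ c i) →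
      (linearCombination ℤ t c = 0 ↔ ∀ i, ((p * n i : ℕ) : ℤ) ∣ c i) by
    refine ⟨fun h₀ ↦ (h fun i ↦ ?_).1 h₀, fun hd ↦ (h fun i ↦ ?_).2 hd⟩
    · exact (Int.natCast_dvd_natCast.2 (hn i)).trans
        ((nsmul_eq_zero_iff c).1 (by rw [h₀, smul_zero]) i)
    · exact (Int.natCast_dvd_natCast.2 (dvd_mul_right _ _)).trans (hd i)
  intro hc
  obtain ⟨c, rfl⟩ := exists_eq_nsmul_of_forall_dvd hc
  rw [map_nsmul, nsmul_eq_zero_iff]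
  simp [mul_dvd_mul_iff_left, hp]

theorem IsCyclicBasis.exists_of_nsmul_range {M : Type v} [AddCommGroup M] {I : Type v} {p : ℕ}
    (hp : p.Prime) {n : I → ℕ} (hn : ∀ i, p ∣ n i)
    {y : I → (nsmulAddMonoidHom p : M →+ M).range} (hy : IsCyclicBasis y n) :
    ∃ (J : Type v) (z : I ⊕ J → M), IsCyclicBasis z (Sum.elim (fun i ↦ p * n i) fun _ ↦ p) := by
  let r := (nsmulAddMonoidHom p : M →+ M).rangeRestrict
  choose t ht using fun i ↦ AddMonoidHom.rangeRestrict_surjective _ (y i)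
  obtain rfl : r ∘ t = y := funext ht
  obtain ⟨J, b, hb, hbU, hbT⟩ :=
    exists_torsion_basis_mod hp (linearCombination ℤ t).toAddMonoidHom.range
  have lc_sum (c : I →₀ ℤ) (d : J →₀ ℤ) : linearCombination ℤ (Sum.elim t b) (c.sumElim d) =
      linearCombination ℤ t c + linearCombination ℤ b d := by
    simp [sumElim_eq_add, linearCombination_mapDomain]
  refine ⟨J, Sum.elim t b, fun c ↦ ?_, fun x ↦ ?_⟩
  · obtain ⟨⟨c, d⟩, rfl⟩ := sumFinsuppEquivProdFinsupp.symm.surjective c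
    change linearCombination ℤ _ (c.sumElim d) = 0 ↔ ∀ i, _ ∣ c.sumElim d i
    rw [lc_sum, Sum.forall]
    simp only [Sum.elim_inl, Sum.elim_inr, sumElim_inl, sumElim_inr]
    rw [← hy.linearCombination_eq_zero_iff_of_nsmul hp.ne_zero hn]
    constructor
    · intro h
      have hd : ∀ j, (p : ℤ) ∣ d j := hbU d ⟨-c, by
        rw [LinearMap.toAddMonoidHom_coe, map_neg, neg_eq_iff_add_eq_zero, h]⟩
      rw [linearCombination_eq_zero_of_forall_dvd hb hd, add_zero] at h
      exact ⟨h, hd⟩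
    · rintro ⟨hc, hd⟩
      rw [hc, linearCombination_eq_zero_of_forall_dvd hb hd, add_zero]
  · obtain ⟨c, hc⟩ := hy.linearCombination_surjective (r x)
    rw [← map_linearCombination_int] at hc
    have hpx : p • (x - linearCombination ℤ t c) = 0 := by
      rw [smul_sub, sub_eq_zero]
      exact (Subtype.ext_iff.1 hc).symm
    obtain ⟨d, c', hd⟩ := hbT _ hpx
    refine ⟨(c' + c).sumElim d, ?_⟩
    rw [lc_sum, map_add, show linearCombination ℤ t c' = _ from hd]
    abel

/-- Prüfer's theorem for abelian groups of bounded `p`-power exponent. -/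
theorem exists_isCyclicBasis_of_prime_pow_nsmul {p : ℕ} (hp : p.Prime) (k : ℕ) :
    ∀ (M : Type v) [AddCommGroup M], (∀ x : M, p ^ k • x = 0) →
      ∃ (I : Type v) (a : I → ℕ) (y : I → M),
        (∀ i, a i < k) ∧ IsCyclicBasis y fun i ↦ p ^ (a i + 1) := by
  induction k with
  | zero =>
    intro M _ h
    have h₀ (x : M) : x = 0 := by simpa using h x
    exact ⟨PEmpty, fun _ ↦ 0, PEmpty.elim, nofun,
      fun c ↦ ⟨fun _ ↦ nofun, fun _ ↦ h₀ _⟩, fun x ↦ ⟨0, (h₀ _).trans (h₀ x).symm⟩⟩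
  | succ k ih =>
    intro M _ h
    obtain ⟨I, a, y, ha, hy⟩ := ih (nsmulAddMonoidHom p : M →+ M).range (by
      rintro ⟨_, x, rfl⟩
      exact Subtype.ext (by simpa [pow_succ, mul_smul] using h x))
    obtain ⟨J, z, hz⟩ := hy.exists_of_nsmul_range hp fun i ↦ dvd_pow_self p (a i).succ_ne_zero
    refine ⟨I ⊕ J, Sum.elim (fun i ↦ a i + 1) fun _ ↦ 0, z, ?_, ?_⟩
    · rintro (i | _)
      · exact Nat.succ_lt_succ (ha i)
      · exact k.succ_pos
    · convert hz using 2 with s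
      rcases s with i | j <;> simp [pow_succ, mul_comm]

end CyclicBasis

theorem finite_range_nsmul_directSum {I : Type*} {p k : ℕ} (hp : p ≠ 0) (a : I → ℕ)
    (ha : ∀ i, a i ≤ k + 1) (hfin : {i | a i = k + 1}.Finite) :
    (Set.range fun x : ⨁ i, ZMod (p ^ a i) ↦ p ^ k • x).Finite := by
  have (i : I) : NeZero (p ^ a i) := ⟨pow_ne_zero _ hp⟩
  have : Finite {i | a i = k + 1} := hfin
  let res (x : ⨁ i, ZMod (p ^ a i)) (i : {i | a i = k + 1}) : ZMod (p ^ a i) := x i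
  refine Set.Finite.of_finite_image (f := res) (Set.toFinite _) ?_
  rintro _ ⟨x, rfl⟩ _ ⟨y, rfl⟩ hxy
  refine DFinsupp.ext fun i ↦ ?_
  by_cases hi : a i = k + 1
  · exact congrFun hxy ⟨i, hi⟩
  · have hdvd : p ^ a i ∣ p ^ k := pow_dvd_pow _ (by have := ha i; omega)
    have h₀ (z : ZMod (p ^ a i)) : p ^ k • z = 0 := by
      rw [nsmul_eq_mul, (ZMod.natCast_eq_zero_iff _ _).2 hdvd, zero_mul]
    change p ^ k • x i = p ^ k • y i
    rw [h₀, h₀]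

section PrimaryComponent

variable {B : Type v} [CommGroup B] {p : ℕ}

theorem nsmul_ordProj_exponent_eq_zero (hp : p.Prime) (hB : Monoid.ExponentExists B)
    (x : Additive (CommGroup.primaryComponent B p)) : ordProj[p] (Monoid.exponent B) • x = 0 := by
  obtain ⟨⟨b, j, hj⟩, rfl⟩ := Additive.ofMul.surjective x
  have h₁ : orderOf b ∣ p ^ j := orderOf_dvd_of_pow_eq_one hj
  have h₂ : orderOf b ∣ ordProj[p] (Monoid.exponent B) * ordCompl[p] (Monoid.exponent B) := by
    rw [Nat.ordProj_mul_ordCompl_eq_self]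
    exact Monoid.order_dvd_exponent b
  have hcop := Nat.coprime_ordCompl hp (Monoid.exponent_ne_zero.2 hB)
  exact Subtype.ext (orderOf_dvd_iff_pow_eq_one.1
    ((hcop.pow_left j).coprime_dvd_left h₁ |>.dvd_of_dvd_mul_right h₂))

theorem pow_ordCompl_exponent_mem_primaryComponent (b : B) :
    b ^ ordCompl[p] (Monoid.exponent B) ∈ CommGroup.primaryComponent B p := by
  refine ⟨(Monoid.exponent B).factorization p, ?_⟩
  rw [← pow_mul, mul_comm, Nat.ordProj_mul_ordCompl_eq_self]
  exact Monoid.pow_exponent_eq_one b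

theorem finite_range_pow_of_not_hasInfinitelyManySummands (hp : p.Prime)
    (hB : Monoid.ExponentExists B) (hpn : p ∣ Monoid.exponent B)
    (h : ¬ HasInfinitelyManySummands B p ((Monoid.exponent B).factorization p)) :
    (Set.range fun b : B ↦ b ^ (Monoid.exponent B / p)).Finite := by
  have hn : Monoid.exponent B ≠ 0 := Monoid.exponent_ne_zero.2 hB
  obtain ⟨k, hk⟩ : ∃ k, (Monoid.exponent B).factorization p = k + 1 :=
    Nat.exists_eq_succ_of_ne_zero (hp.factorization_pos_of_dvd hn hpn).ne'
  have hdiv : Monoid.exponent B / p = ordCompl[p] (Monoid.exponent B) * p ^ k :=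
    Nat.div_eq_of_eq_mul_left hp.pos (by
      rw [mul_assoc, ← pow_succ, ← hk, Nat.mul_comm, Nat.ordProj_mul_ordCompl_eq_self])
  obtain ⟨I, a, y, ha, hy⟩ := exists_isCyclicBasis_of_prime_pow_nsmul hp (k + 1) _
    fun x ↦ hk ▸ nsmul_ordProj_exponent_eq_zero hp hB x
  obtain ⟨e⟩ := hy.nonempty_addEquiv
  have hfin : {i | a i + 1 = k + 1}.Finite := by
    by_contra hinf
    exact h ⟨I, fun i ↦ a i + 1, ⟨e⟩, hk ▸ hinf⟩
  refine ((finite_range_nsmul_directSum hp.ne_zero _ (fun i ↦ ha i) hfin).image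
    fun x ↦ ((e.symm x).toMul : B)).subset ?_
  rintro _ ⟨b, rfl⟩
  refine ⟨_, ⟨e (Additive.ofMul ⟨_, pow_ordCompl_exponent_mem_primaryComponent b⟩), rfl⟩, ?_⟩
  simp only [map_nsmul, AddEquiv.symm_apply_apply]
  rw [hdiv, pow_mul]
  rfl

theorem HasInfinitelyManySummands.exists_injective {k : ℕ} (h : HasInfinitelyManySummands B p k) :
    ∃ f : (ℕ →₀ ZMod (p ^ k)) →+ Additive B, Function.Injective f := by
  classical
  obtain ⟨I, a, ⟨e⟩, hinf⟩ := h
  have : Infinite {i | a i = k} := hinf.to_subtype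
  let t : ℕ ↪ {i | a i = k} := Infinite.natEmbedding _
  let c (j : ℕ) : ZMod (p ^ k) ≃+ ZMod (p ^ a (t j)) :=
    (ZMod.ringEquivCongr (by rw [(t j).2])).toAddEquiv
  let g : (ℕ →₀ ZMod (p ^ k)) →+ ⨁ i, ZMod (p ^ a i) := Finsupp.liftAddHom fun j ↦
    (DirectSum.of (fun i ↦ ZMod (p ^ a i)) (t j)).comp (c j).toAddMonoidHom
  have g_apply (x : ℕ →₀ ZMod (p ^ k)) (j : ℕ) : g x (t j) = c j (x j) := by
    simp only [g, Finsupp.liftAddHom_apply]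
    rw [Finsupp.sum, DirectSum.sum_apply, Finset.sum_eq_single j]
    · exact DirectSum.of_eq_same _ _
    · intro i _ hij
      exact DirectSum.of_eq_of_ne _ _ _ fun h ↦ hij (t.injective (Subtype.ext h)).symm
    · simp +contextual
  have g_injective : Function.Injective g := fun x y hxy ↦
    Finsupp.ext fun j ↦ (c j).injective (by rw [← g_apply, ← g_apply, hxy])
  let s : Additive (CommGroup.primaryComponent B p) →+ Additive B :=
    (CommGroup.primaryComponent B p).subtype.toAdditive
  exact ⟨(s.comp e.symm.toAddMonoidHom).comp g,
    (Subtype.val_injective.comp e.symm.injective).comp g_injective⟩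

end PrimaryComponent

section Laws

open scoped commutatorElement

variable {G : Type u} {H : Type v} [Group G] [Group H]

theorem map_freeGroupLift {α : Type*} (φ : G →* H) (f : α → G) (x : FreeGroup α) :
    φ (FreeGroup.lift f x) = FreeGroup.lift (φ ∘ f) x :=
  FreeGroup.lift_unique (φ.comp (FreeGroup.lift f)) (by simp)

theorem freeGroupLift_lift {α β : Type*} (f : β → G) (g : α → FreeGroup β) (x : FreeGroup α) :
    FreeGroup.lift f (FreeGroup.lift g x) = FreeGroup.lift (fun i ↦ FreeGroup.lift f (g i)) x :=
  map_freeGroupLift _ _ _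

theorem SatisfiesLaw.of_injective {x : FreeGroup ℕ} (h : SatisfiesLaw H x) (φ : G →* H)
    (hφ : Function.Injective φ) : SatisfiesLaw G x := fun f ↦
  hφ (by rw [map_freeGroupLift, h, map_one])

theorem SatisfiesLaw.of_surjective {x : FreeGroup ℕ} (h : SatisfiesLaw G x) (φ : G →* H)
    (hφ : Function.Surjective φ) : SatisfiesLaw H x := fun f ↦ by
  choose g hg using fun i ↦ hφ (f i)
  obtain rfl : φ ∘ g = f := funext hg
  rw [← map_freeGroupLift, h, map_one]

theorem SatisfiesLaw.pi {x : FreeGroup ℕ} (h : SatisfiesLaw G x) (ι : Type*) :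
    SatisfiesLaw (ι → G) x := fun f ↦ funext fun i ↦
  (map_freeGroupLift (Pi.evalMonoidHom (fun _ : ι ↦ G) i) f x).trans (h _)

theorem SatisfiesLaw.lift {x : FreeGroup ℕ} (h : SatisfiesLaw G x) (f : ℕ → FreeGroup ℕ) :
    SatisfiesLaw G (FreeGroup.lift f x) := fun g ↦ by
  rw [freeGroupLift_lift]
  exact h _

theorem satisfiesLaw_commutator_iff :
    SatisfiesLaw G ⁅FreeGroup.of 0, FreeGroup.of 1⁆ ↔ ∀ a b : G, a * b = b * a := by
  constructor
  · intro h a b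
    simpa [map_commutatorElement, commutatorElement_eq_one_iff_mul_comm] using
      h fun i ↦ if i = 0 then a else b
  · intro h f
    rw [map_commutatorElement, commutatorElement_eq_one_iff_mul_comm]
    exact h _ _

theorem satisfiesLaw_pow_iff (n : ℕ) :
    SatisfiesLaw G (FreeGroup.of 0 ^ n) ↔ ∀ a : G, a ^ n = 1 :=
  ⟨fun h a ↦ by simpa using h fun _ ↦ a, fun h f ↦ by simp [h]⟩

theorem mem_generatedVariety_iff {K : GrpCat.{w}} :
    K ∈ generatedVariety.{u, w} G ↔ ∀ x, SatisfiesLaw G x → SatisfiesLaw K x := by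
  simp only [generatedVariety, varietyOfLaws, Set.mem_iInter, Set.mem_ofPred_eq]
  exact ⟨fun h x hx ↦ h {x} (by simpa using hx) x rfl, fun h S hS x hx ↦ h x (hS x hx)⟩

theorem generatedVariety_subset_of_injective (φ : G →* H) (hφ : Function.Injective φ) :
    generatedVariety.{u, w} G ⊆ generatedVariety.{v, w} H := fun K hK ↦ by
  rw [mem_generatedVariety_iff] at hK ⊢
  exact fun x hx ↦ hK x (hx.of_injective φ hφ)

theorem mul_comm_of_mem_generatedVariety {A : Type u} [CommGroup A] {N : Type w} [Group N]
    (hN : GrpCat.of N ∈ generatedVariety.{u, w} A) (y z : N) : y * z = z * y :=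
  satisfiesLaw_commutator_iff.1
    (mem_generatedVariety_iff.1 hN _ (satisfiesLaw_commutator_iff.2 mul_comm)) y z

theorem pow_exponent_eq_one_of_mem_generatedVariety {N : Type w} [Group N]
    (hN : GrpCat.of N ∈ generatedVariety.{u, w} G) (z : N) : z ^ Monoid.exponent G = 1 :=
  (satisfiesLaw_pow_iff _).1
    (mem_generatedVariety_iff.1 hN _ ((satisfiesLaw_pow_iff _).2 Monoid.pow_exponent_eq_one)) z

end Laws

section VerbalSubgroup

variable (B : Type v) [Group B] (H : Type w) [Group H]

/-- The verbal subgroup of `H` formed by the values of the laws of `B`. The laws used in two values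
are put in disjoint sets of variables, of even and odd index, to multiply the values. -/
def verbalSubgroup : Subgroup H where
  carrier := {h | ∃ x, SatisfiesLaw B x ∧ ∃ f : ℕ → H, FreeGroup.lift f x = h}
  one_mem' := ⟨1, fun _ ↦ map_one _, fun _ ↦ 1, map_one _⟩
  mul_mem' := by
    rintro _ _ ⟨x, hx, f, rfl⟩ ⟨y, hy, g, rfl⟩
    refine ⟨FreeGroup.lift (fun i ↦ FreeGroup.of (2 * i)) x *
      FreeGroup.lift (fun i ↦ FreeGroup.of (2 * i + 1)) y, fun k ↦ ?_,
      fun i ↦ if i % 2 = 0 then f (i / 2) else g (i / 2), ?_⟩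
    · rw [map_mul, hx.lift, hy.lift, one_mul]
    · rw [map_mul, freeGroupLift_lift, freeGroupLift_lift]
      congr 3 <;> funext i
      · simp
      · simp [Nat.add_mod, show (2 * i + 1) / 2 = i by omega]
  inv_mem' := by
    rintro _ ⟨x, hx, f, rfl⟩
    exact ⟨x⁻¹, fun k ↦ by rw [map_inv, hx, inv_one], f, map_inv _ _⟩

instance : (verbalSubgroup B H).Normal where
  conj_mem := by
    rintro _ ⟨x, hx, f, rfl⟩ g
    exact ⟨x, hx, _, (map_freeGroupLift (MulAut.conj g).toMonoidHom f x).symm⟩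

variable {B H}

theorem satisfiesLaw_quotient_verbalSubgroup {x : FreeGroup ℕ} (hx : SatisfiesLaw B x) :
    SatisfiesLaw (H ⧸ verbalSubgroup B H) x := fun f ↦ by
  choose g hg using fun i ↦ QuotientGroup.mk'_surjective (verbalSubgroup B H) (f i)
  obtain rfl : QuotientGroup.mk' (verbalSubgroup B H) ∘ g = f := funext hg
  rw [← map_freeGroupLift]
  exact (QuotientGroup.eq_one_iff _).2 ⟨x, hx, g, rfl⟩

end VerbalSubgroup

section WreathProduct

open RegularWreathProduct

variable {A : Type u} {B : Type v} [Group A] [Group B]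

/-- The embedding of the base group into the wreath product. -/
def wreathBaseHom (A : Type u) (B : Type v) [Group A] [Group B] : (B → A) →* A ≀ᵣ B where
  toFun f := ⟨f, 1⟩
  map_one' := rfl
  map_mul' f g := by ext <;> simp

theorem exists_wreathBaseHom_eq {g : A ≀ᵣ B} (hg : g.right = 1) : ∃ f, wreathBaseHom A B f = g :=
  ⟨g.left, by ext <;> simp [wreathBaseHom, hg]⟩

theorem right_freeGroupLift (f : ℕ → A ≀ᵣ B) (x : FreeGroup ℕ) :
    (FreeGroup.lift f x).right = FreeGroup.lift (fun i ↦ (f i).right) x :=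
  map_freeGroupLift (rightHom : A ≀ᵣ B →* B) f x

/-- The embedding of `B` into the direct wreath product. -/
def directWreathInl (A : Type u) (B : Type v) [Group A] [Group B] : B →* directWreathProduct A B :=
  inl.codRestrict _ fun b ↦ by
    change (Function.mulSupport (1 : B → A)).Finite
    simp

theorem directWreathInl_injective : Function.Injective (directWreathInl A B) := fun _ _ h ↦
  congrArg (fun z : directWreathProduct A B ↦ z.1.right) h

theorem satisfiesLaw_wreath_lift {x : FreeGroup ℕ} (hx : SatisfiesLaw A x) {b : ℕ → FreeGroup ℕ}
    (hb : ∀ i, SatisfiesLaw B (b i)) : SatisfiesLaw (A ≀ᵣ B) (FreeGroup.lift b x) := fun f ↦ by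
  rw [freeGroupLift_lift]
  choose g hg using fun i ↦ exists_wreathBaseHom_eq
    (show (FreeGroup.lift f (b i)).right = 1 by rw [right_freeGroupLift, hb])
  simp_rw [← hg]
  rw [show (fun i ↦ wreathBaseHom A B (g i)) = wreathBaseHom A B ∘ g from rfl,
    ← map_freeGroupLift, hx.pi, map_one]

theorem generatedVariety_wreath_subset : generatedVariety.{max u v, w} (A ≀ᵣ B) ⊆
    productVariety (generatedVariety.{u, w} A) (generatedVariety.{v, w} B) := by
  intro H hH
  rw [mem_generatedVariety_iff] at hH
  refine ⟨verbalSubgroup B H, inferInstance, ?_, ?_⟩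
  · rw [mem_generatedVariety_iff]
    intro x hx f
    choose b hb g hg using fun i ↦ (f i).2
    -- The laws `b i` are substituted into `x` in pairwise disjoint sets of variables.
    have hlaw := satisfiesLaw_wreath_lift hx (b := fun i ↦ FreeGroup.lift
      (fun j ↦ FreeGroup.of (Nat.pair i j)) (b i)) (fun i ↦ (hb i).lift _)
    have hval := hH _ hlaw fun k ↦ g k.unpair.1 k.unpair.2
    simp only [freeGroupLift_lift, FreeGroup.lift_apply_of, Nat.unpair_pair, hg] at hval
    exact Subtype.ext ((map_freeGroupLift (verbalSubgroup B H).subtype f x).trans hval)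
  · rw [mem_generatedVariety_iff]
    exact fun x hx ↦ satisfiesLaw_quotient_verbalSubgroup hx

theorem wreath_mem_productVariety {N Q : Type w} [Group N] [Group Q]
    (hN : GrpCat.of N ∈ generatedVariety.{u, w} A) (hQ : GrpCat.of Q ∈ generatedVariety.{v, w} B) :
    GrpCat.of (N ≀ᵣ Q) ∈
      productVariety (generatedVariety.{u, w} A) (generatedVariety.{v, w} B) := by
  rw [mem_generatedVariety_iff] at hN hQ
  refine ⟨(rightHom : N ≀ᵣ Q →* Q).ker, inferInstance, ?_, ?_⟩
  · rw [mem_generatedVariety_iff]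
    intro x hx
    refine SatisfiesLaw.of_surjective (G := Q → N) ((hN x hx).pi Q)
      ((wreathBaseHom N Q).codRestrict _ fun f ↦ by rw [MonoidHom.mem_ker]; rfl) ?_
    rintro ⟨g, hg⟩
    obtain ⟨f, rfl⟩ := exists_wreathBaseHom_eq (show g.right = 1 from hg)
    exact ⟨f, rfl⟩
  · rw [mem_generatedVariety_iff]
    intro x hx
    exact (hQ x hx).of_injective (QuotientGroup.kerLift (rightHom : N ≀ᵣ Q →* Q))
      (QuotientGroup.kerLift_injective _)

/-- The Kaloujnine–Krasner embedding of an extension into a wreath product, for the coset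
representatives `Quotient.out`. -/
noncomputable def kaloujnineKrasner {G : Type*} [Group G] (N : Subgroup G) [N.Normal] :
    G →* N ≀ᵣ (G ⧸ N) where
  toFun g := ⟨fun x ↦ ⟨(Quotient.out x)⁻¹ * g * Quotient.out ((g : G ⧸ N)⁻¹ * x), by
    rw [← QuotientGroup.eq_one_iff, QuotientGroup.mk_mul, QuotientGroup.mk_mul,
      QuotientGroup.mk_inv, QuotientGroup.out_eq', QuotientGroup.out_eq']
    group⟩, g⟩
  map_one' := by ext <;> simp
  map_mul' g h := by ext <;> simp [mul_assoc]

theorem kaloujnineKrasner_injective {G : Type*} [Group G] (N : Subgroup G) [N.Normal] :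
    Function.Injective (kaloujnineKrasner N) := by
  refine (injective_iff_map_eq_one _).2 fun g hg ↦ ?_
  have hr : (g : G ⧸ N) = 1 := congrArg RegularWreathProduct.right hg
  have hl : (Quotient.out (1 : G ⧸ N))⁻¹ * g * Quotient.out ((g : G ⧸ N)⁻¹ * 1) = 1 :=
    congrArg Subtype.val (congrFun (congrArg RegularWreathProduct.left hg) 1)
  rw [hr, inv_one, one_mul] at hl
  exact (conj_eq_one_iff (a := (Quotient.out (1 : G ⧸ N))⁻¹)).1 (by rwa [inv_inv])

end WreathProduct

section Detection

/-- The divisibility by `m` of an element of the group ring `ℤ[V]` can be checked on its images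
under the homomorphisms from `V` to `C`. -/
def DetectsDvd (V C : Type*) [AddCommGroup V] [AddCommGroup C] (m : ℕ) : Prop :=
  ∀ v : V →₀ ℤ, (∀ (φ : V →+ C) (z : C), (m : ℤ) ∣ v.mapDomain φ z) → ∀ h, (m : ℤ) ∣ v h

variable {V C : Type*} [AddCommGroup V] [AddCommGroup C]

theorem DetectsDvd.of_exists_injOn (hC : ∀ S : Finset V, ∃ φ : V →+ C, Set.InjOn φ S) (m : ℕ) :
    DetectsDvd V C m := fun v hv h ↦ by
  classical
  obtain ⟨φ, hφ⟩ := hC (insert h v.support)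
  rw [← Finsupp.mapDomain_apply' _ v (Finset.coe_subset.2 (Finset.subset_insert _ _)) hφ
    (Finset.mem_insert_self _ _)]
  exact hv φ (φ h)

theorem DetectsDvd.of_injective {V' C' : Type*} [AddCommGroup V'] [AddCommGroup C'] {m : ℕ}
    (h : DetectsDvd V' C' m) (f : V →+ V') (hf : Function.Injective f) (g : C' →+ C)
    (hg : Function.Injective g) : DetectsDvd V C m := fun v hv x ↦ by
  rw [← Finsupp.mapDomain_apply hf]
  refine h _ (fun φ z ↦ ?_) _
  rw [← Finsupp.mapDomain_comp, ← Finsupp.mapDomain_apply hg, ← Finsupp.mapDomain_comp]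
  exact hv (g.comp (φ.comp f)) _

theorem mapDomain_prodMap_id_apply {α β γ : Type*} (f : β → γ) (c : α × β →₀ ℤ) (i : α) (z : γ) :
    c.mapDomain (Prod.map id f) (i, z) = (c.curry i).mapDomain f z := by
  classical
  induction c using Finsupp.induction_linear with
  | zero =>
    rw [show (0 : α × β →₀ ℤ).curry = 0 from map_zero Finsupp.curryAddEquiv]
    simp
  | add c₁ c₂ h₁ h₂ =>
    rw [show (c₁ + c₂).curry = c₁.curry + c₂.curry from map_add Finsupp.curryAddEquiv c₁ c₂]
    simp [Finsupp.mapDomain_add, h₁, h₂]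
  | single j a =>
    obtain ⟨j, b⟩ := j
    by_cases hj : j = i
    · subst hj
      simp [Finsupp.single_apply]
    · simp [hj]

theorem DetectsDvd.dvd_of_prodMap_id {X : Type*} {m : ℕ} (hV : DetectsDvd V C m) (c : X × V →₀ ℤ)
    (hc : ∀ (φ : V →+ C) (i : X × C), (m : ℤ) ∣ c.mapDomain (Prod.map id φ) i) (i : X × V) :
    (m : ℤ) ∣ c i :=
  hV (c.curry i.1) (fun φ z ↦ by simpa only [mapDomain_prodMap_id_apply] using hc φ (i.1, z)) i.2

theorem DetectsDvd.prod {V' C' : Type*} [AddCommGroup V'] [AddCommGroup C'] {m : ℕ}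
    (hV : DetectsDvd V C m) (hV' : DetectsDvd V' C' m) : DetectsDvd (V × V') (C × C') m := by
  intro v hv
  refine hV'.dvd_of_prodMap_id v fun φ' i ↦ ?_
  rw [← Finsupp.mapDomain_apply Prod.swap_injective]
  refine hV.dvd_of_prodMap_id _ (fun φ j ↦ ?_) _
  rw [← Finsupp.mapDomain_apply Prod.swap_injective, ← Finsupp.mapDomain_comp,
    ← Finsupp.mapDomain_comp, ← Finsupp.mapDomain_comp]
  exact hv (φ.prodMap φ') _

theorem DetectsDvd.of_prime_pow {m : ℕ}
    (h : ∀ p j : ℕ, p.Prime → j ≠ 0 → p ^ j ∣ m → DetectsDvd V C (p ^ j)) :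
    DetectsDvd V C m := by
  intro v hv x
  rw [Int.natCast_dvd, Nat.dvd_iff_prime_pow_dvd_dvd]
  intro p j hp hj
  rcases j.eq_zero_or_pos with rfl | hj0
  · simp
  · have hjm : ((p ^ j : ℕ) : ℤ) ∣ m := Int.natCast_dvd_natCast.2 hj
    exact Int.natCast_dvd.1
      (h p j hp hj0.ne' hj v (fun φ z ↦ hjm.trans (hv φ z)) x)

theorem dvd_mul_of_forall_dvd_mapDomain {J : Type*} [Fintype J] [DecidableEq V] (φ : J → V →+ C)
    (F : C → ℤ) (v : V →₀ ℤ) {m N : ℤ} (hφ : ∀ j z, m ∣ v.mapDomain (φ j) z) (h₀ : V)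
    (hF : ∀ h ∈ v.support, ∑ j, F (φ j (h - h₀)) = if h = h₀ then N else 0) : m ∣ N * v h₀ := by
  have key : N * v h₀ = ∑ j, (v.mapDomain (φ j)).sum fun z c ↦ c * F (z - φ j h₀) := by
    calc N * v h₀ = v.sum fun h c ↦ c * ∑ j, F (φ j (h - h₀)) := by
          rw [Finsupp.sum, Finset.sum_congr rfl fun h hh ↦ by rw [hF h hh]]
          simp only [mul_ite, mul_zero, Finset.sum_ite_eq', Finsupp.mem_support_iff, ite_not]
          split_ifs with h <;> simp [h, mul_comm]
      _ = ∑ j, v.sum fun h c ↦ c * F (φ j h - φ j h₀) := by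
          simp only [Finsupp.sum, Finset.mul_sum, map_sub]
          exact Finset.sum_comm
      _ = _ := Finset.sum_congr rfl fun j _ ↦ by
          rw [Finsupp.sum_mapDomain_index (by simp) (by intros; ring)]
  rw [key]
  exact Finset.dvd_sum fun j _ ↦ Finset.dvd_sum fun z _ ↦ (hφ j z).mul_right _

end Detection

section Fourier

open ArithmeticFunction
open scoped ArithmeticFunction.Moebius ArithmeticFunction.zeta

variable {n : ℕ}

theorem exists_dvd_forall_intCast_mem_iff (H : AddSubgroup (ZMod n)) :
    ∃ g : ℕ, g ∣ n ∧ ∀ a : ℤ, (a : ZMod n) ∈ H ↔ (g : ℤ) ∣ a := by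
  obtain ⟨g, hg⟩ := Int.subgroup_cyclic (H.comap (Int.castAddHom (ZMod n)))
  have hmem (a : ℤ) : (a : ZMod n) ∈ H ↔ (g.natAbs : ℤ) ∣ a := by
    rw [Int.natAbs_dvd, ← Int.mem_zmultiples_iff, AddSubgroup.zmultiples_eq_closure, ← hg]
    rfl
  refine ⟨g.natAbs, ?_, hmem⟩
  rw [← Int.natCast_dvd_natCast, ← hmem, Int.cast_natCast, ZMod.natCast_self]
  exact H.zero_mem

theorem sum_divisors_moebius_ite_mem (hn : n ≠ 0) (H : AddSubgroup (ZMod n))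
    [DecidablePred (· ∈ H)] [Decidable (H = ⊥)] :
    ∑ e ∈ n.divisors, (if ((n / e : ℕ) : ZMod n) ∈ H then μ e else 0) =
      if H = ⊥ then 1 else 0 := by
  obtain ⟨g, ⟨d, rfl⟩, hg⟩ := exists_dvd_forall_intCast_mem_iff H
  have hg0 : 0 < g := Nat.pos_of_ne_zero (left_ne_zero_of_mul hn)
  have hbot : H = ⊥ ↔ d = 1 := by
    constructor
    · intro h
      have hgH := (hg g).2 dvd_rfl
      rw [h, AddSubgroup.mem_bot, Int.cast_natCast, ZMod.natCast_eq_zero_iff] at hgH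
      exact Nat.dvd_one.1 (Nat.dvd_of_mul_dvd_mul_left hg0 (by simpa using hgH))
    · rintro rfl
      refine (AddSubgroup.eq_bot_iff_forall _).2 fun x hx ↦ ?_
      obtain ⟨a, rfl⟩ := ZMod.intCast_surjective x
      exact (ZMod.intCast_zmod_eq_zero_iff_dvd _ _).2 (by simpa using (hg a).1 hx)
  have hmem {e : ℕ} (he : e ∈ (g * d).divisors) : ((g * d / e : ℕ) : ZMod (g * d)) ∈ H ↔ e ∣ d := by
    rw [← Int.cast_natCast, hg, Int.natCast_dvd_natCast,
      Nat.dvd_div_iff_mul_dvd (Nat.dvd_of_mem_divisors he), mul_comm,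
      Nat.mul_dvd_mul_iff_left hg0]
  rw [Finset.sum_congr rfl fun e he ↦ if_congr (hmem he) rfl rfl, ← Finset.sum_filter,
    Nat.divisors_filter_dvd_of_dvd hn (dvd_mul_left d g), ← coe_mul_zeta_apply,
    moebius_mul_coe_zeta, one_apply]
  exact if_congr hbot.symm rfl rfl

/-- A function on `ℤ/n` whose sum along a homomorphism from a finite group to `ℤ/n` vanishes,
unless the homomorphism does. -/
def moebiusWeight (n : ℕ) (z : ZMod n) : ℤ :=
  ∑ e ∈ n.divisors, if z = (n / e : ℕ) then μ e else 0

theorem sum_moebiusWeight (hn : n ≠ 0) {G : Type*} [AddCommGroup G] [Fintype G] (L : G →+ ZMod n)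
    [Decidable (L = 0)] :
    ∑ g, moebiusWeight n (L g) = if L = 0 then (Fintype.card G : ℤ) else 0 := by
  classical
  have hfib (z : ZMod n) : (Finset.univ.filter (L · = z)).card =
      if z ∈ L.range then (Finset.univ.filter (L · = 0)).card else 0 := by
    split_ifs with hz
    · exact AddMonoidHom.card_fiber_eq_of_mem_range L hz ⟨0, map_zero L⟩
    · exact Finset.card_eq_zero.2 (Finset.filter_eq_empty_iff.2 fun g _ h ↦ hz ⟨g, h⟩)
  have hbot : L.range = ⊥ ↔ L = 0 := AddMonoidHom.range_eq_bot_iff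
  calc ∑ g, moebiusWeight n (L g)
      = ∑ e ∈ n.divisors, ((Finset.univ.filter (L · = ((n / e : ℕ) : ZMod n))).card : ℤ) * μ e := by
        simp only [moebiusWeight]
        rw [Finset.sum_comm]
        refine Finset.sum_congr rfl fun e _ ↦ ?_
        rw [← Finset.sum_filter, Finset.sum_const, nsmul_eq_mul]
    _ = (Finset.univ.filter (L · = 0)).card *
          ∑ e ∈ n.divisors, (if ((n / e : ℕ) : ZMod n) ∈ L.range then μ e else 0) := by
        rw [Finset.mul_sum]
        refine Finset.sum_congr rfl fun e _ ↦ ?_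
        rw [hfib, Nat.cast_ite, Nat.cast_zero, ite_mul, zero_mul, mul_ite, mul_zero]
    _ = _ := by
        rw [sum_divisors_moebius_ite_mem hn, mul_ite, mul_one, mul_zero]
        split_ifs with h h' h'
        · obtain rfl := h'
          simp
        · exact absurd (hbot.1 h) h'
        · exact absurd (hbot.2 h') h
        · rfl

theorem sum_moebiusWeight_sum_mul [NeZero n] {ι : Type*} [DecidableEq ι] {T : Finset ι}
    {h : ι →₀ ZMod n} [Decidable (h = 0)] (hT : h.support ⊆ T) :
    ∑ ψ : T → ZMod n, moebiusWeight n (∑ t : T, ψ t * h t) =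
      if h = 0 then (n : ℤ) ^ T.card else 0 := by
  classical
  let L : (T → ZMod n) →+ ZMod n :=
    ∑ t : T, (AddMonoidHom.mulRight (h t)).comp (Pi.evalAddMonoidHom _ t)
  have hL (ψ) : L ψ = ∑ t : T, ψ t * h t := by simp [L, AddMonoidHom.finsetSum_apply]
  have hL0 : L = 0 ↔ h = 0 := by
    constructor
    · intro h0
      ext i
      by_cases hi : i ∈ T
      · simpa [hL, Pi.single_apply] using DFunLike.congr_fun h0 (Pi.single ⟨i, hi⟩ 1)
      · exact Finsupp.notMem_support_iff.1 fun hi' ↦ hi (hT hi')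
    · rintro rfl
      ext ψ
      simp [L]
  simp only [← hL, sum_moebiusWeight (NeZero.ne n), hL0]
  simp

theorem detectsDvd_finsupp_zmod (ι : Type*) {m : ℕ} (hn : n ≠ 0)
    (hm : ∀ x : ℤ, (m : ℤ) ∣ n * x → (m : ℤ) ∣ x) : DetectsDvd (ι →₀ ZMod n) (ZMod n) m := by
  classical
  intro v hv h₀
  have : NeZero n := ⟨hn⟩
  let T : Finset ι := (insert h₀ v.support).biUnion Finsupp.support
  have hT {h : ι →₀ ZMod n} (hh : h ∈ v.support) : (h - h₀).support ⊆ T :=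
    Finsupp.support_sub.trans (Finset.union_subset
      (Finset.subset_biUnion_of_mem Finsupp.support (Finset.mem_insert_of_mem hh))
      (Finset.subset_biUnion_of_mem Finsupp.support (Finset.mem_insert_self _ _)))
  let φ (ψ : T → ZMod n) : (ι →₀ ZMod n) →+ ZMod n :=
    ∑ t : T, (AddMonoidHom.mulLeft (ψ t)).comp (Finsupp.applyAddHom t.1)
  have hφ (ψ h) : φ ψ h = ∑ t, ψ t * h t := by simp [φ, AddMonoidHom.finsetSum_apply]
  have hdvd : (m : ℤ) ∣ (n : ℤ) ^ T.card * v h₀ := by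
    refine dvd_mul_of_forall_dvd_mapDomain φ (moebiusWeight n) v (fun ψ ↦ hv (φ ψ)) h₀
      fun h hh ↦ ?_
    simp only [hφ, sum_moebiusWeight_sum_mul (hT hh), sub_eq_zero]
  generalize T.card = r at hdvd
  induction r with
  | zero => simpa using hdvd
  | succ r ih => exact ih (hm _ (by rwa [← mul_assoc, ← pow_succ']))

end Fourier

section Criterion

theorem exists_zmod_addMonoidHom_injective {C : Type*} [AddCommGroup C] (c : C) :
    ∃ f : ZMod (addOrderOf c) →+ C, Function.Injective f := by
  refine ⟨ZMod.lift _ ⟨zmultiplesHom C c, by simp⟩, (ZMod.lift_injective _).2 fun a ha ↦ ?_⟩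
  exact (ZMod.intCast_zmod_eq_zero_iff_dvd _ _).2 (addOrderOf_dvd_iff_zsmul_eq_zero.2 ha)

theorem exists_addMonoidHom_int_injOn (S : Finset (ℕ →₀ ℤ)) :
    ∃ t : (ℕ →₀ ℤ) →+ ℤ, Set.InjOn t S := by
  classical
  let P := (Polynomial.basisMonomials ℤ).repr.symm
  have hne : ∏ z ∈ S.offDiag, (P z.1 - P z.2) ≠ 0 := Finset.prod_ne_zero_iff.2 fun z hz ↦
    sub_ne_zero.2 (P.injective.ne (Finset.mem_offDiag.1 hz).2.2)
  obtain ⟨a, ha⟩ : ∃ a, (∏ z ∈ S.offDiag, (P z.1 - P z.2)).eval a ≠ 0 := by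
    by_contra! h
    exact hne (Polynomial.funext fun a ↦ by rw [h a, Polynomial.eval_zero])
  rw [Polynomial.eval_prod, Finset.prod_ne_zero_iff] at ha
  refine ⟨(Polynomial.leval a ∘ₗ P.toLinearMap).toAddMonoidHom, fun x hx y hy hxy ↦ ?_⟩
  by_contra h
  exact ha (x, y) (Finset.mem_offDiag.2 ⟨hx, hy, h⟩)
    (by rw [Polynomial.eval_sub, sub_eq_zero]; exact hxy)

theorem exists_addMonoidHom_injOn {C : Type*} [AddCommGroup C]
    (hC : ∀ j : ℕ, j ≠ 0 → ∃ c : C, j • c ≠ 0) (S : Finset (ℕ →₀ ℤ)) :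
    ∃ φ : (ℕ →₀ ℤ) →+ C, Set.InjOn φ S := by
  classical
  obtain ⟨t, ht⟩ := exists_addMonoidHom_int_injOn S
  obtain ⟨c, hc⟩ := hC (∏ z ∈ S.offDiag, (t z.1 - t z.2)).natAbs <|
    Int.natAbs_ne_zero.2 <| Finset.prod_ne_zero_iff.2 fun z hz ↦ by
      obtain ⟨hx, hy, hxy⟩ := Finset.mem_offDiag.1 hz
      exact sub_ne_zero.2 (ht.ne hx hy hxy)
  refine ⟨(zmultiplesHom C c).comp t, fun x hx y hy hxy ↦ ?_⟩
  by_contra h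
  have hdvd : t x - t y ∣ ∏ z ∈ S.offDiag, (t z.1 - t z.2) :=
    Finset.dvd_prod_of_mem (fun z ↦ t z.1 - t z.2) (a := (x, y)) (Finset.mem_offDiag.2 ⟨hx, hy, h⟩)
  have hzero : (t x - t y) • c = 0 := by rw [sub_smul, sub_eq_zero]; exact hxy
  rw [Ne, natAbs_nsmul_eq_zero, ← addOrderOf_dvd_iff_zsmul_eq_zero] at hc
  exact hc ((addOrderOf_dvd_iff_zsmul_eq_zero.2 hzero).trans hdvd)

theorem coprod_injective_of_coprime {V V' C : Type*} [AddCommGroup V] [AddCommGroup V']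
    [AddCommGroup C] {a b : ℕ} (hab : a.Coprime b) (hV : ∀ x : V, a • x = 0)
    (hV' : ∀ y : V', b • y = 0) {f : V →+ C} (hf : Function.Injective f) {g : V' →+ C}
    (hg : Function.Injective g) : Function.Injective (f.coprod g) := by
  refine (injective_iff_map_eq_zero _).2 fun ⟨x, y⟩ hxy ↦ ?_
  rw [AddMonoidHom.coprod_apply] at hxy
  have hbx : b • x = 0 := hf <| by
    simpa [← map_nsmul, hV'] using congrArg (b • ·) hxy
  have hx : x = 0 := AddMonoid.addOrderOf_eq_one_iff.1 <| Nat.eq_one_of_dvd_coprimes hab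
    (addOrderOf_dvd_of_nsmul_eq_zero (hV x)) (addOrderOf_dvd_of_nsmul_eq_zero hbx)
  subst hx
  rw [map_zero, zero_add, ← map_zero g] at hxy
  exact Prod.ext rfl (hg hxy)

theorem DetectsDvd.finsupp_zmod_mul {C : Type*} [AddCommGroup C] {a b m : ℕ} (hab : a.Coprime b)
    (hb : b ≠ 0) (hm : m.Coprime b) {f : (ℕ →₀ ZMod a) →+ C} (hf : Function.Injective f)
    {g : ZMod b →+ C} (hg : Function.Injective g) : DetectsDvd (ℕ →₀ ZMod (a * b)) C m := by
  have hid : DetectsDvd (ℕ →₀ ZMod a) (ℕ →₀ ZMod a) m :=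
    .of_exists_injOn (fun _ ↦ ⟨AddMonoidHom.id _, Function.injective_id.injOn⟩) m
  refine (hid.prod (detectsDvd_finsupp_zmod ℕ hb fun x ↦ ?_)).of_injective
    ((Finsupp.mapRange.addMonoidHom
        (ZMod.castHom (dvd_mul_right a b) (ZMod a)).toAddMonoidHom).prod
      (Finsupp.mapRange.addMonoidHom
        (ZMod.castHom (dvd_mul_left b a) (ZMod b)).toAddMonoidHom))
    ((injective_iff_map_eq_zero _).2 fun h hh ↦ ?_) (f.coprod g)
    (coprod_injective_of_coprime hab (fun x ↦ by ext; simp) (fun y ↦ by simp) hf hg)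
  · exact (Nat.isCoprime_iff_coprime.2 hm).dvd_of_dvd_mul_left
  · obtain ⟨ha, hb⟩ := Prod.ext_iff.1 hh
    ext i
    have hai : ZMod.castHom (dvd_mul_right a b) (ZMod a) (h i) = 0 := DFunLike.congr_fun ha i
    have hbi : ZMod.castHom (dvd_mul_left b a) (ZMod b) (h i) = 0 := DFunLike.congr_fun hb i
    obtain ⟨c, hc⟩ := ZMod.intCast_surjective (h i)
    rw [← hc, map_intCast, ZMod.intCast_zmod_eq_zero_iff_dvd] at hai hbi
    rw [← hc, Finsupp.zero_apply, ZMod.intCast_zmod_eq_zero_iff_dvd, Nat.cast_mul]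
    exact (Nat.isCoprime_iff_coprime.2 hab).mul_dvd hai hbi

variable {A : Type u} {B : Type v} [CommGroup A] [CommGroup B]

theorem detectsDvd_of_not_exponentExists (hB : ¬ Monoid.ExponentExists B) (m : ℕ) :
    DetectsDvd (ℕ →₀ ℤ) (Additive B) m :=
  .of_exists_injOn (exists_addMonoidHom_injOn fun j hj ↦ by
    by_contra! h
    exact hB ⟨j, Nat.pos_of_ne_zero hj, h⟩) m

theorem exists_zmod_injective_of_dvd_exponent (hB : Monoid.ExponentExists B) {d : ℕ}
    (hd : d ∣ Monoid.exponent B) : ∃ f : ZMod d →+ Additive B, Function.Injective f := by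
  obtain ⟨b, hb⟩ := Monoid.exists_orderOf_eq_exponent hB
  obtain ⟨e, he⟩ := hd
  have he0 : e ≠ 0 := right_ne_zero_of_mul (he ▸ Monoid.exponent_ne_zero.2 hB)
  have hord : addOrderOf (Additive.ofMul (b ^ e)) = d := by
    rw [addOrderOf_ofMul_eq_orderOf, orderOf_pow_of_dvd he0 (hb ▸ he ▸ dvd_mul_left e d), hb, he,
      Nat.mul_div_cancel _ (Nat.pos_of_ne_zero he0)]
  exact hord ▸ exists_zmod_addMonoidHom_injective _

theorem detectsDvd_prime_pow (hB : Monoid.ExponentExists B) {p : ℕ} (hp : p.Prime)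
    (hpB : p ∣ Monoid.exponent B →
      HasInfinitelyManySummands B p ((Monoid.exponent B).factorization p)) (j : ℕ) :
    DetectsDvd (ℕ →₀ ZMod (Monoid.exponent B)) (Additive B) (p ^ j) := by
  have hn := Monoid.exponent_ne_zero.2 hB
  have hcop := Nat.coprime_ordCompl hp hn
  obtain ⟨f, hf⟩ : ∃ f : (ℕ →₀ ZMod (p ^ (Monoid.exponent B).factorization p)) →+ Additive B,
      Function.Injective f := by
    by_cases h : p ∣ Monoid.exponent B
    · exact (hpB h).exists_injective
    · rw [Nat.factorization_eq_zero_of_not_dvd h, pow_zero]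
      exact ⟨0, Function.injective_of_subsingleton _⟩
  obtain ⟨g, hg⟩ := exists_zmod_injective_of_dvd_exponent hB (Nat.ordCompl_dvd _ p)
  have h := DetectsDvd.finsupp_zmod_mul (hcop.pow_left _) (Nat.ordCompl_pos p hn).ne'
    (hcop.pow_left j) hf hg
  rwa [Nat.ordProj_mul_ordCompl_eq_self] at h

theorem WreathCriterion.detectsDvd (h : WreathCriterion A B) :
    DetectsDvd (ℕ →₀ ZMod (Monoid.exponent B)) (Additive B) (Monoid.exponent A) := by
  by_cases hB : Monoid.ExponentExists B
  · by_cases hA : Monoid.ExponentExists A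
    · have hsummands := (h.resolve_left (by simp [hA, hB])).2.2
      exact .of_prime_pow fun p j hp hj hjA ↦
        detectsDvd_prime_pow hB hp (hsummands p hp ((dvd_pow_self p hj).trans hjA)) j
    · obtain ⟨f, hf⟩ := exists_zmod_injective_of_dvd_exponent hB dvd_rfl
      have hn := Monoid.exponent_ne_zero.2 hB
      rw [Monoid.exponent_eq_zero_iff.2 hA]
      exact (detectsDvd_finsupp_zmod ℕ hn (by simp [hn])).of_injective
        (AddMonoidHom.id _) Function.injective_id f hf
  · rw [Monoid.exponent_eq_zero_iff.2 hB]
    exact detectsDvd_of_not_exponentExists hB _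

end Criterion

section Fox

/-- The action of a group by left translation on the free module with basis `ℕ × Γ`, which is
the free module over `ℤ[Γ]` with basis `ℕ`. -/
noncomputable def foxTranslation (Γ : Type*) [Group Γ] :
    Γ →* MulAut (Multiplicative (ℕ × Γ →₀ ℤ)) where
  toFun g := AddEquiv.toMultiplicative
    (Finsupp.domCongr ((Equiv.refl ℕ).prodCongr (Equiv.mulLeft g)))
  map_one' := by
    refine MulEquiv.ext fun d ↦ Multiplicative.toAdd.injective (Finsupp.ext fun i ↦ ?_)
    change d.toAdd (i.1, 1⁻¹ * i.2) = d.toAdd i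
    rw [inv_one, one_mul]
  map_mul' g h := by
    refine MulEquiv.ext fun d ↦ Multiplicative.toAdd.injective (Finsupp.ext fun i ↦ ?_)
    change d.toAdd (i.1, (g * h)⁻¹ * i.2) = d.toAdd (i.1, h⁻¹ * (g⁻¹ * i.2))
    rw [mul_inv_rev, mul_assoc]

variable {Γ Δ : Type*} [Group Γ] [Group Δ]

theorem toAdd_foxTranslation (g : Γ) (d : Multiplicative (ℕ × Γ →₀ ℤ)) :
    (foxTranslation Γ g d).toAdd = d.toAdd.mapDomain (Prod.map id (g * ·)) :=
  Finsupp.domCongr_apply _ _ |>.trans (Finsupp.equivMapDomain_eq_mapDomain _ _)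

/-- The Magnus representation of the free group, with the variables specialised to the elements
`γ i` in the second component. -/
noncomputable def magnusHom (γ : ℕ → Γ) :
    FreeGroup ℕ →* Multiplicative (ℕ × Γ →₀ ℤ) ⋊[foxTranslation Γ] Γ :=
  FreeGroup.lift fun i ↦ ⟨Multiplicative.ofAdd (Finsupp.single (i, 1) 1), γ i⟩

/-- The Fox derivatives of a word, with the variables specialised to the elements `γ i`: the value
at `(i, g)` is the coefficient of `g` in the derivative with respect to the variable `i`. -/
noncomputable def foxCoeff (γ : ℕ → Γ) (x : FreeGroup ℕ) : ℕ × Γ →₀ ℤ :=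
  (magnusHom γ x).left.toAdd

theorem foxCoeff_comp (φ : Γ →* Δ) (γ : ℕ → Γ) (x : FreeGroup ℕ) :
    foxCoeff (φ ∘ γ) x = (foxCoeff γ x).mapDomain (Prod.map id φ) := by
  let Θ : Multiplicative (ℕ × Γ →₀ ℤ) ⋊[foxTranslation Γ] Γ →*
      Multiplicative (ℕ × Δ →₀ ℤ) ⋊[foxTranslation Δ] Δ :=
    SemidirectProduct.map
      (AddMonoidHom.toMultiplicative (Finsupp.mapDomain.addMonoidHom (Prod.map id φ))) φ
      fun g ↦ MonoidHom.ext fun d ↦ Multiplicative.toAdd.injective <| by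
        change Finsupp.mapDomain _ (foxTranslation Γ g d).toAdd =
          (foxTranslation Δ (φ g) (Multiplicative.ofAdd (d.toAdd.mapDomain _))).toAdd
        simp only [toAdd_foxTranslation, toAdd_ofAdd, ← Finsupp.mapDomain_comp]
        congr 1
        ext i <;> simp
  have h : Θ (magnusHom γ x) = magnusHom (φ ∘ γ) x := by
    rw [magnusHom, map_freeGroupLift]
    congr 2
    funext i
    ext1
    · exact congrArg Multiplicative.ofAdd (Finsupp.mapDomain_single.trans (by simp))
    · rfl
  rw [foxCoeff, ← h]
  rfl

variable {N : Type u} {Q : Type v} [CommGroup N] [Group Q]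

/-- The value at `y` of the element of the base group obtained by applying a tuple of elements of
the group ring of `Q` to the left components of the elements `σ i`. -/
noncomputable def foxEval (σ : ℕ → N ≀ᵣ Q) (y : Q) : (ℕ × Q →₀ ℤ) →+ Additive N :=
  Finsupp.liftAddHom fun i ↦ zmultiplesHom _ (Additive.ofMul ((σ i.1).left (i.2⁻¹ * y)))

theorem foxEval_translation (σ : ℕ → N ≀ᵣ Q) (y g : Q) (d : Multiplicative (ℕ × Q →₀ ℤ)) :
    foxEval σ y (foxTranslation Q g d).toAdd = foxEval σ (g⁻¹ * y) d.toAdd := by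
  rw [toAdd_foxTranslation, foxEval, foxEval, Finsupp.liftAddHom_apply, Finsupp.liftAddHom_apply,
    Finsupp.sum_mapDomain_index_addMonoidHom]
  exact Finsupp.sum_congr fun i _ ↦ by simp [mul_assoc]

theorem left_freeGroupLift_eq_foxEval (σ : ℕ → N ≀ᵣ Q) (x : FreeGroup ℕ) (y : Q) :
    (FreeGroup.lift σ x).left y = (foxEval σ y (foxCoeff (fun i ↦ (σ i).right) x)).toMul := by
  let Θ : Multiplicative (ℕ × Q →₀ ℤ) ⋊[foxTranslation Q] Q →* N ≀ᵣ Q :=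
    { toFun := fun s ↦ ⟨fun y ↦ (foxEval σ y s.left.toAdd).toMul, s.right⟩
      map_one' := by ext <;> simp
      map_mul' := fun s t ↦ by ext <;> simp [foxEval_translation] }
  have h : Θ (magnusHom (fun i ↦ (σ i).right) x) = FreeGroup.lift σ x := by
    rw [magnusHom, map_freeGroupLift]
    congr 2
    funext i
    ext y <;> simp [Θ, foxEval]
  rw [← h]
  rfl

theorem satisfiesLaw_wreath_of_dvd_foxCoeff {x : FreeGroup ℕ} {m : ℕ} (hm : ∀ z : N, z ^ m = 1)
    (hx : SatisfiesLaw Q x) (h : ∀ (γ : ℕ → Q) (i : ℕ × Q), (m : ℤ) ∣ foxCoeff γ x i) :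
    SatisfiesLaw (N ≀ᵣ Q) x := fun σ ↦ by
  ext y
  · rw [left_freeGroupLift_eq_foxEval, foxEval, Finsupp.liftAddHom_apply, Finsupp.sum,
      Finset.sum_eq_zero]
    · rfl
    · intro i _
      obtain ⟨c, hc⟩ := h (fun i ↦ (σ i).right) i
      rw [hc, zmultiplesHom_apply, mul_comm, mul_smul, natCast_zsmul, ← ofMul_pow, hm, ofMul_one,
        smul_zero]
  · rw [right_freeGroupLift, hx]
    rfl

theorem exponent_dvd_foxCoeff {x : FreeGroup ℕ} (h : SatisfiesLaw (directWreathProduct N Q) x)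
    (γ : ℕ → Q) (i : ℕ × Q) : (Monoid.exponent N : ℤ) ∣ foxCoeff γ x i := by
  classical
  rw [Int.natCast_dvd, Monoid.exponent_dvd_iff_forall_pow_eq_one]
  intro a
  rw [pow_natAbs_eq_one]
  -- This substitution isolates the coefficient of `i.2` in the `i.1`-th Fox derivative.
  let σ (j : ℕ) : directWreathProduct N Q :=
    ⟨⟨if j = i.1 then Pi.mulSingle 1 a else 1, γ j⟩, by
      change (Function.mulSupport (if j = i.1 then Pi.mulSingle 1 a else 1)).Finite
      split_ifs
      · exact (Set.finite_singleton 1).subset Pi.mulSupport_mulSingle_subset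
      · simp⟩
  have hleft : (FreeGroup.lift (fun j ↦ (σ j : N ≀ᵣ Q)) x).left i.2 = 1 := by
    rw [show (fun j ↦ (σ j : N ≀ᵣ Q)) = (directWreathProduct N Q).subtype ∘ σ from rfl,
      ← map_freeGroupLift, h, map_one]
    rfl
  rw [left_freeGroupLift_eq_foxEval, foxEval, Finsupp.liftAddHom_apply,
    Finsupp.sum_eq_single i] at hleft
  · simpa [σ] using hleft
  · intro j _ hj
    by_cases hji : j.1 = i.1
    · have : j.2⁻¹ * i.2 ≠ 1 := fun h ↦ hj (Prod.ext hji (inv_mul_eq_one.1 h))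
      simp [σ, hji, Pi.mulSingle_eq_of_ne this]
    · simp [σ, hji]
  · simp

end Fox

section Sufficiency

variable {A : Type u} {B : Type v} [CommGroup A] [CommGroup B]

theorem exists_finsupp_zmod_lift {Q : Type*} [CommGroup Q] {n : ℕ} (hQ : ∀ z : Q, z ^ n = 1)
    (γ : ℕ → Q) : ∃ φ : Multiplicative (ℕ →₀ ZMod n) →* Q,
      φ ∘ (fun j ↦ Multiplicative.ofAdd (Finsupp.single j 1)) = γ := by
  let : Module (ZMod n) (Additive Q) := AddCommGroup.zmodModule (n := n) hQ
  exact ⟨AddMonoidHom.toMultiplicativeLeft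
    (Finsupp.linearCombination (ZMod n) fun j ↦ Additive.ofMul (γ j)).toAddMonoidHom, by
      funext j; simp⟩

theorem WreathCriterion.satisfiesLaw_wreath (h : WreathCriterion A B) {N Q : Type*} [CommGroup N]
    [CommGroup Q] (hN : ∀ z : N, z ^ Monoid.exponent A = 1)
    (hQ : ∀ z : Q, z ^ Monoid.exponent B = 1) {x : FreeGroup ℕ}
    (hx : SatisfiesLaw (directWreathProduct A B) x) (hxQ : SatisfiesLaw Q x) :
    SatisfiesLaw (N ≀ᵣ Q) x := by
  let ε (j : ℕ) : Multiplicative (ℕ →₀ ZMod (Monoid.exponent B)) :=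
    Multiplicative.ofAdd (Finsupp.single j 1)
  have hε (i) : (Monoid.exponent A : ℤ) ∣ foxCoeff ε x i := by
    refine h.detectsDvd.dvd_of_prodMap_id (foxCoeff ε x :) (fun φ j ↦ ?_) i
    have hφ := exponent_dvd_foxCoeff hx (AddMonoidHom.toMultiplicativeLeft φ ∘ ε) j
    rwa [foxCoeff_comp] at hφ
  refine satisfiesLaw_wreath_of_dvd_foxCoeff hN hxQ fun γ i ↦ ?_
  obtain ⟨φ, rfl⟩ := exists_finsupp_zmod_lift hQ γ
  classical
  rw [foxCoeff_comp, Finsupp.mapDomain, Finsupp.sum_apply]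
  refine Finset.dvd_sum fun j _ ↦ ?_
  simp only [Finsupp.single_apply]
  split_ifs
  · exact hε j
  · exact dvd_zero _

theorem WreathCriterion.productVariety_subset (h : WreathCriterion A B) :
    productVariety (generatedVariety.{u, w} A) (generatedVariety.{v, w} B) ⊆
      generatedVariety.{max u v, w} (directWreathProduct A B) := by
  rintro G ⟨N, hnorm, hN, hQ⟩
  let : CommGroup N := { (inferInstance : Group N) with
    mul_comm := mul_comm_of_mem_generatedVariety hN }
  let : CommGroup (G ⧸ N) := { (inferInstance : Group (G ⧸ N)) with
    mul_comm := mul_comm_of_mem_generatedVariety hQ }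
  refine mem_generatedVariety_iff.2 fun x hx ↦
    SatisfiesLaw.of_injective ?_ _ (kaloujnineKrasner_injective N)
  have hxB : SatisfiesLaw B x := hx.of_injective _ directWreathInl_injective
  exact h.satisfiesLaw_wreath (pow_exponent_eq_one_of_mem_generatedVariety hN)
    (pow_exponent_eq_one_of_mem_generatedVariety hQ) hx (mem_generatedVariety_iff.1 hQ x hxB)

end Sufficiency

section Necessity

open scoped commutatorElement
open RegularWreathProduct

/-- The left-normed commutator `[[[z, y 0], y 1], …, y (k - 1)]`. -/
def leftCommutator {G : Type*} [Group G] (z : G) (y : ℕ → G) : ℕ → G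
  | 0 => z
  | k + 1 => ⁅leftCommutator z y k, y k⁆

theorem map_leftCommutator {G H : Type*} [Group G] [Group H] (φ : G →* H) (z : G) (y : ℕ → G)
    (k : ℕ) : φ (leftCommutator z y k) = leftCommutator (φ z) (φ ∘ y) k := by
  induction k with
  | zero => rfl
  | succ k ih => rw [leftCommutator, leftCommutator, map_commutatorElement, ih, Function.comp_apply]

theorem leftCommutator_succ' {G : Type*} [Group G] (z : G) (y : ℕ → G) (k : ℕ) :
    leftCommutator z y (k + 1) = leftCommutator ⁅z, y 0⁆ (fun i ↦ y (i + 1)) k := by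
  induction k with
  | zero => rfl
  | succ k ih => rw [leftCommutator, ih, leftCommutator]

theorem commutator_wreathBaseHom {A B : Type*} [CommGroup A] [Group B] (f : B → A) (g : A ≀ᵣ B) :
    ⁅wreathBaseHom A B f, g⁆ = wreathBaseHom A B fun x ↦ f x * (f (g.right⁻¹ * x))⁻¹ := by
  rw [commutatorElement_def]
  ext x
  · simp [wreathBaseHom, mul_assoc, mul_left_comm]
  · simp [wreathBaseHom]

section GroupRing

variable {A : Type u} {B : Type v} [CommGroup A] [CommGroup B]

/-- The action of `B` by translations on the base group of the wreath product. -/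
def baseTranslation (A : Type u) (B : Type v) [CommGroup A] [CommGroup B] :
    B →* Module.End ℤ (Additive (B → A)) where
  toFun b := AddMonoidHom.toIntLinearMap
    { toFun := fun f ↦ Additive.ofMul fun x ↦ f.toMul (b⁻¹ * x)
      map_zero' := rfl
      map_add' := fun _ _ ↦ rfl }
  map_one' := by
    refine LinearMap.ext fun f ↦ Additive.toMul.injective (funext fun x ↦ ?_)
    change f.toMul (1⁻¹ * x) = f.toMul x
    rw [inv_one, one_mul]
  map_mul' b c := by
    refine LinearMap.ext fun f ↦ Additive.toMul.injective (funext fun x ↦ ?_)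
    change f.toMul ((b * c)⁻¹ * x) = f.toMul (c⁻¹ * (b⁻¹ * x))
    rw [mul_inv_rev, mul_assoc]

/-- The action of the integral group ring of `B` on the base group of the wreath product. -/
noncomputable def baseAction (A : Type u) (B : Type v) [CommGroup A] [CommGroup B] :
    MonoidAlgebra ℤ B →ₐ[ℤ] Module.End ℤ (Additive (B → A)) :=
  MonoidAlgebra.lift ℤ (Module.End ℤ (Additive (B → A))) B (baseTranslation A B)

theorem leftCommutator_wreathBaseHom (f : B → A) (g : ℕ → A ≀ᵣ B) (k : ℕ) :
    leftCommutator (wreathBaseHom A B f) g k = wreathBaseHom A B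
      (baseAction A B (∏ i ∈ Finset.range k, (1 - MonoidAlgebra.of ℤ B (g i).right))
        (Additive.ofMul f)).toMul := by
  induction k with
  | zero => simp [leftCommutator]
  | succ k ih =>
    rw [leftCommutator, ih, commutator_wreathBaseHom, Finset.prod_range_succ, mul_comm, map_mul]
    congr 1
    funext x
    rw [Module.End.mul_apply, map_sub, map_one, LinearMap.sub_apply, Module.End.one_apply,
      baseAction, MonoidAlgebra.lift_of, toMul_sub, div_eq_mul_inv]
    rfl

theorem prime_dvd_one_sub_pow {R : Type*} [CommRing R] {p : ℕ} (hp : p.Prime) {t : R}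
    (ht : t ^ p = 1) : (p : R) ∣ (1 - t) ^ p := by
  obtain ⟨r, hr⟩ := exists_add_pow_prime_eq hp (1 : R) (-t)
  rw [← sub_eq_add_neg, one_pow] at hr
  rw [hr, mul_assoc, mul_assoc]
  refine dvd_add ?_ (dvd_mul_right _ _)
  rcases hp.eq_two_or_odd' with rfl | hodd
  · rw [neg_sq, ht, one_add_one_eq_two, Nat.cast_two]
  · rw [hodd.neg_pow, ht, add_neg_cancel]
    exact dvd_zero _

theorem prime_dvd_prod_one_sub {R ι : Type*} [CommRing R] {p : ℕ} (hp : p.Prime) {t : ι → R}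
    {T : Finset ι} (ht : ∀ i ∈ T, t i ^ p = 1) {τ : ℕ → ι} (hτ : ∀ j, τ j ∈ T) :
    (p : R) ∣ ∏ j ∈ Finset.range (T.card * p), (1 - t (τ j)) := by
  classical
  -- One of the factors occurs at least `p` times.
  obtain ⟨i, hi, hcard⟩ := Finset.exists_le_card_fiber_of_mul_le_card_of_maps_to
    (s := Finset.range (T.card * p)) (n := p) (fun j _ ↦ hτ j) ⟨τ 0, hτ 0⟩
    (by rw [Finset.card_range])
  refine ((prime_dvd_one_sub_pow hp (ht i hi)).trans (pow_dvd_pow _ hcard)).trans ?_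
  rw [← Finset.prod_const, Finset.prod_congr rfl fun j hj ↦ by rw [← (Finset.mem_filter.1 hj).2]]
  exact Finset.prod_dvd_prod_of_subset _ _ _ (Finset.filter_subset _ _)

theorem leftCommutator_wreathBaseHom_pow_eq_one {p d : ℕ} (hp : p.Prime)
    (hA : ∀ a : A, a ^ (d * p) = 1) {T : Finset B} (hT : ∀ t ∈ T, t ^ p = 1) (f : B → A)
    {g : ℕ → A ≀ᵣ B} (hg : ∀ i, (g i).right ∈ T) :
    leftCommutator (wreathBaseHom A B f) g (T.card * p) ^ d = 1 := by
  obtain ⟨r, hr⟩ := prime_dvd_prod_one_sub hp (t := MonoidAlgebra.of ℤ B)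
    (fun t ht ↦ by rw [← map_pow, hT t ht, map_one]) hg
  rw [leftCommutator_wreathBaseHom, hr, ← map_pow, ← toMul_nsmul, map_mul, map_natCast,
    Module.End.mul_apply, Module.End.natCast_apply, smul_smul, toMul_nsmul]
  exact (congrArg _ (funext fun x ↦ hA _)).trans (map_one _)

end GroupRing

/-- The word `[[x₀, x₁], x₂ ^ e, x₃ ^ e, …] ^ d` with `l` entries of the form `xᵢ ^ e`. -/
def commutatorPowerWord (e d l : ℕ) : FreeGroup ℕ :=
  leftCommutator ⁅FreeGroup.of 0, FreeGroup.of 1⁆ (fun i ↦ FreeGroup.of (i + 2) ^ e) l ^ d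

theorem freeGroupLift_commutatorPowerWord {G : Type*} [Group G] (σ : ℕ → G) (e d l : ℕ) :
    FreeGroup.lift σ (commutatorPowerWord e d l) =
      leftCommutator ⁅σ 0, σ 1⁆ (fun i ↦ σ (i + 2) ^ e) l ^ d := by
  rw [commutatorPowerWord, map_pow, map_leftCommutator, map_commutatorElement]
  simp only [Function.comp_def, map_pow, FreeGroup.lift_apply_of]

theorem satisfiesLaw_commutatorPowerWord {A B : Type*} [CommGroup A] [CommGroup B] {p d e : ℕ}
    (hp : p.Prime) (hA : ∀ a : A, a ^ (d * p) = 1) {T : Finset B} (hT : ∀ t ∈ T, t ^ p = 1)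
    (hBT : ∀ b : B, b ^ e ∈ T) :
    SatisfiesLaw (A ≀ᵣ B) (commutatorPowerWord e d (T.card * p)) := fun σ ↦ by
  obtain ⟨f, hf⟩ := exists_wreathBaseHom_eq (g := ⁅σ 0, σ 1⁆) <| by
    rw [← rightHom_eq_right, map_commutatorElement, commutatorElement_eq_one_iff_mul_comm, mul_comm]
  rw [freeGroupLift_commutatorPowerWord, ← hf]
  refine leftCommutator_wreathBaseHom_pow_eq_one hp hA hT f fun i ↦ ?_
  rw [← rightHom_eq_right, map_pow]
  exact hBT _

section Pi

variable {N C : Type*} [CommGroup N] [CommGroup C]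

theorem exists_leftCommutator_mulSingle_eq [DecidableEq (ℕ → C)] {c : ℕ → C} (hc : ∀ i, c i ≠ 1)
    (a : N) (k : ℕ) : ∃ F : (ℕ → C) → N,
      leftCommutator (wreathBaseHom N (ℕ → C) (Pi.mulSingle 1 a))
          (fun i ↦ inl (Pi.mulSingle i (c i))) k = wreathBaseHom N (ℕ → C) F ∧
        F 1 = a ∧ ∀ x j, k ≤ j → x j ≠ 1 → F x = 1 := by
  induction k with
  | zero =>
    refine ⟨_, rfl, Pi.mulSingle_eq_same (M := fun _ ↦ N) 1 a, fun x j _ hx ↦ ?_⟩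
    exact Pi.mulSingle_eq_of_ne (M := fun _ ↦ N) (ne_of_apply_ne (· j) hx) a
  | succ k ih =>
    obtain ⟨F, hF, hF1, hFs⟩ := ih
    refine ⟨_, by rw [leftCommutator, hF, commutator_wreathBaseHom], ?_, fun x j hj hx ↦ ?_⟩
    · rw [hF1, hFs _ k le_rfl (by simpa using hc k), inv_one, mul_one]
    · rw [hFs x j (by omega) hx, hFs _ j (by omega), inv_one, mul_one]
      simpa [Pi.mulSingle_eq_of_ne (show j ≠ k by omega)] using hx

theorem not_satisfiesLaw_commutatorPowerWord {e d : ℕ} {a : N} {c : C} (ha : a ^ d ≠ 1)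
    (hc : c ^ e ≠ 1) (l : ℕ) : ¬ SatisfiesLaw (N ≀ᵣ (ℕ → C)) (commutatorPowerWord e d l) := by
  classical
  intro h
  let c' : ℕ → C
    | 0 => c
    | _ + 1 => c ^ e
  have hc' : ∀ i, c' i ≠ 1
    | 0 => by rintro rfl; exact hc (one_pow e)
    | _ + 1 => hc
  let σ : ℕ → N ≀ᵣ (ℕ → C)
    | 0 => wreathBaseHom N (ℕ → C) (Pi.mulSingle 1 a)
    | i + 1 => inl (Pi.mulSingle i c)
  have hσ (i : ℕ) : σ (i + 2) ^ e = inl (Pi.mulSingle (i + 1) (c' (i + 1))) := by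
    rw [Pi.mulSingle_pow, map_pow]
  obtain ⟨F, hF, hF1, -⟩ := exists_leftCommutator_mulSingle_eq hc' a (l + 1)
  have hval : wreathBaseHom N (ℕ → C) F ^ d = 1 := by
    rw [← hF, leftCommutator_succ', ← h σ, freeGroupLift_commutatorPowerWord]
    simp only [hσ]
    rfl
  rw [← map_pow] at hval
  have hone : F 1 ^ d = 1 := congrFun (congrArg RegularWreathProduct.left hval) 1
  exact ha (hF1 ▸ hone)

end Pi

variable {A : Type u} {B : Type v} [CommGroup A] [CommGroup B]

theorem zmod_exponent_mem_generatedVariety (hA : Monoid.ExponentExists A) :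
    GrpCat.of (ULift.{w} (Multiplicative (ZMod (Monoid.exponent A)))) ∈
      generatedVariety.{u, w} A := by
  obtain ⟨f, hf⟩ := exists_zmod_injective_of_dvd_exponent hA dvd_rfl
  exact mem_generatedVariety_iff.2 fun x hx ↦ hx.of_injective
    ((AddMonoidHom.toMultiplicativeLeft f).comp MulEquiv.ulift.toMonoidHom)
    (hf.comp ULift.down_injective)

theorem exists_ulift_zmod_pow_ne_one {n d : ℕ} (hd : ¬ n ∣ d) :
    ∃ c : ULift.{w} (Multiplicative (ZMod n)), c ^ d ≠ 1 := by
  refine ⟨⟨Multiplicative.ofAdd 1⟩, fun h ↦ hd ?_⟩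
  have h1 : Multiplicative.ofAdd (1 : ZMod n) ^ d = 1 := congrArg ULift.down h
  rwa [← ofAdd_nsmul, ofAdd_eq_one, nsmul_one, ZMod.natCast_eq_zero_iff] at h1

theorem exists_law_of_not_wreathCriterion (h : ¬ WreathCriterion A B) :
    ∃ x, SatisfiesLaw (A ≀ᵣ B) x ∧
      ∃ G ∈ productVariety (generatedVariety.{u, w} A) (generatedVariety.{v, w} B),
        ¬ SatisfiesLaw G x := by
  rw [WreathCriterion, not_or, not_or, not_not, not_not] at h
  obtain ⟨⟨hA, hB⟩, h⟩ := h
  push Not at h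
  obtain ⟨p, hp, hpA, hpB, h⟩ := h hA hB
  have hfin := finite_range_pow_of_not_hasInfinitelyManySummands hp hB hpB h
  have hndvd {n : ℕ} (hn : n ≠ 0) (hpn : p ∣ n) : ¬ n ∣ n / p :=
    Nat.not_dvd_of_pos_of_lt (Nat.div_pos (Nat.le_of_dvd (Nat.pos_of_ne_zero hn) hpn) hp.pos)
      (Nat.div_lt_self (Nat.pos_of_ne_zero hn) hp.one_lt)
  obtain ⟨a, ha⟩ := exists_ulift_zmod_pow_ne_one.{w} (hndvd (Monoid.exponent_ne_zero.2 hA) hpA)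
  obtain ⟨c, hc⟩ := exists_ulift_zmod_pow_ne_one.{w} (hndvd (Monoid.exponent_ne_zero.2 hB) hpB)
  refine ⟨_, satisfiesLaw_commutatorPowerWord (e := Monoid.exponent B / p)
    (d := Monoid.exponent A / p) (T := hfin.toFinset) hp ?_ ?_ ?_, _,
    wreath_mem_productVariety (zmod_exponent_mem_generatedVariety hA)
      (Q := ℕ → ULift.{w} (Multiplicative (ZMod (Monoid.exponent B)))) ?_,
    not_satisfiesLaw_commutatorPowerWord ha hc _⟩
  · rw [Nat.div_mul_cancel hpA]
    exact Monoid.pow_exponent_eq_one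
  · intro t ht
    obtain ⟨b, rfl⟩ := hfin.mem_toFinset.1 ht
    rw [← pow_mul, Nat.div_mul_cancel hpB, Monoid.pow_exponent_eq_one]
  · exact fun b ↦ hfin.mem_toFinset.2 ⟨b, rfl⟩
  · exact mem_generatedVariety_iff.2 fun x hx ↦
      (mem_generatedVariety_iff.1 (zmod_exponent_mem_generatedVariety hB) x hx).pi ℕ

end Necessity

theorem theorem2p1_general (A : Type u) (B : Type v) [CommGroup A] [CommGroup B] {W : Type*}
    [Group W] (i : directWreathProduct A B →* W) (hi : Function.Injective i) (j : W →* A ≀ᵣ B)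
    (hj : Function.Injective j) :
    generatedVariety.{_, w} W =
        productVariety (generatedVariety.{u, w} A) (generatedVariety.{v, w} B) ↔
      WreathCriterion A B := by
  have hWA := generatedVariety_subset_of_injective.{_, _, w} j hj
  constructor
  · intro heq
    by_contra h
    obtain ⟨x, hx, G, hG, hGx⟩ := exists_law_of_not_wreathCriterion.{u, v, w} h
    exact hGx (mem_generatedVariety_iff.1 (hWA (heq ▸ hG)) x hx)
  · intro h
    exact (hWA.trans generatedVariety_wreath_subset).antisymm
      (h.productVariety_subset.trans (generatedVariety_subset_of_injective i hi))


theorem theorem2p1 (A : Type u) (B : Type v) [CommGroup A] [CommGroup B] :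
    (generatedVariety.{max u v, w} (A ≀ᵣ B) =
        productVariety (generatedVariety.{u, w} A) (generatedVariety.{v, w} B) ↔
      WreathCriterion A B) ∧
    (generatedVariety.{max u v, w} (directWreathProduct A B) =
        productVariety (generatedVariety.{u, w} A) (generatedVariety.{v, w} B) ↔
      WreathCriterion A B) := by
  exact
    ⟨theorem2p1_general A B (directWreathProduct A B).subtype Subtype.val_injective
        (MonoidHom.id _) Function.injective_id,
      theorem2p1_general A B (MonoidHom.id _) Function.injective_id
        (directWreathProduct A B).subtype Subtype.val_injective⟩
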